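/- **Setting.** Consider a connected network with $n\ge 1$ load buses $\mathcal L$ and $m\ge 1$ inverter buses $\mathcal I$ and inductive branches: the susceptance matrix $B=B^{\mathsf T}\in\mathbb R^{(n+m)\times(n+m)}$ satisfies $B_{ij}>0$ if $i\neq j$ are joined by a branch, $B_{ij}=0$ for other $i\ne j$, and $B_{ii}=-\sum_{j\ne i}B_{ij}$. Let $\tau_i>0$, $K_i<0$, $E_i^*>0$ for $i\in\mathcal I$, let $Q_i:\mathbb R_{>0}\to\mathbb R$ be smooth for $i\in\mathcal L$, and write $[x]$ for the diagonal matrix with diagonal $x$, $E=(E_L,E_I)$, $Q_L(E_L)=(Q_i(E_i))_{i\in\mathcal L}$, $K_I=[(K_i)_{i\in\mathcal I}]$, $\tau_I=[(\tau_i)_{i\in\mathcal I}]$. The closed-loop system on positive voltages $E\in\mathbb R^{n+m}_{>0}$ is the differential-algebraic system $$\begin{pmatrix}0\\ \tau_I\dot E_I\end{pmatrix}=\begin{pmatrix}Q_L(E_L)\\ [E_I]K_I(E_I-E_I^*)\end{pmatrix}+[E]BE .$$ Partition $B$ into the blocks $B_{LL},B_{LI},B_{IL},B_{II}$ and put $$B_{\rm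 red}=B_{LL}-B_{LI}(B_{II}+K_I)^{-1}B_{IL},\qquad E_L^*=-B_{\rm red}^{-1}B_{LI}(B_{II}+K_I)^{-1}K_IE_I^* .$$ **Theorem (Stability from Reduced Jacobian).** Let $E_L\in\mathbb R^n_{>0}$ be a solution of the reduced power flow equation $$0=Q_L(E_L)+[E_L]B_{\rm red}(E_L-E_L^*),$$ and let $E_I=(B_{II}+K_I)^{-1}(K_IE_I^*-B_{IL}E_L)$. Then $(E_L,E_I)$ is an equilibrium point of the closed-loop system with positive components, and the Jacobian at $E_L$ of the right-hand side of the reduced power flow equation is $$J_{\rm red}(E_L)=\frac{\partial Q_L}{\partial E_L}(E_L)+[E_L]B_{\rm red}+[B_{\rm red}(E_L-E_L^*)] .$$ If $J_{\rm red}(E_L)$ is Hurwitz (all its eigenvalues have negative real part), then the equilibrium point $(E_L,E_I)$ of the differential-algebraic closed-loop system is locally exponentially stable: there are $\delta,C,\alpha>0$ such that from every $E(0)\in\mathbb R^{n+m}_{>0}$ that satisfies the algebraic equations and has distance less than $\delta$ from $(E_L,E_I)$ starts a solution on $[0,\infty)$, and every solution $E(\cdot)$ with such an initial value satisfies $\|E(t)-(E_L,E_I)\|\le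 Ce^{-\alpha t}\|E(0)-(E_L,E_I)\|$ for all times $t\ge0$ at which it is defined. Moreover, if $\frac{\mathrm dQ_i}{\mathrm dE_i}(E_i)\le 0$ for each $i\in\mathcal L$, then a sufficient condition for $J_{\rm red}(E_L)$ to be Hurwitz is that $B_{\rm red}\prec[E_L]^{-2}[Q_L(E_L)]$, i.e. that $[E_L]^{-2}[Q_L(E_L)]-B_{\rm red}$ is positive definite. -/

import Mathlib

open scoped Matrix ContDiff

/-- A real square matrix is Hurwitz if all its (complex) eigenvalues have negative real part. -/
def IsHurwitz {ι : Type*} [Fintype ι] [DecidableEq ι] (A : Matrix ι ι ℝ) : Prop :=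
  ∀ μ ∈ spectrum ℂ (A.map Complex.ofReal), μ.re < 0

/-- The data of an inductive microgrid with load buses `L` and inverter buses `I`: a connected
network whose branches are inductive, inverters with time constants, controller gains and voltage
set points, and static load models (smooth functions of the positive load voltages). -/
structure Microgrid (L I : Type*) where
  /-- the branches of the network -/
  graph : SimpleGraph (L ⊕ I)
  connected : graph.Connected
  /-- branch susceptances: the branch admittances are `𝐣 b i j` -/
  b : L ⊕ I → L ⊕ I → ℝ
  b_symm : ∀ i j, b i j = b j i
  b_neg : ∀ i j, graph.Adj i j → b i j < 0
  b_zero : ∀ i j, ¬ graph.Adj i j → b i j = 0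
  /-- inverter time constants -/
  τ : I → ℝ
  τ_pos : ∀ i, 0 < τ i
  /-- quadratic droop controller gains -/
  K : I → ℝ
  K_neg : ∀ i, K i < 0
  /-- inverter voltage set points `E_I^*` -/
  Eset : I → ℝ
  Eset_pos : ∀ i, 0 < Eset i
  /-- static load models `Q_i(E_i)` -/
  Q : L → ℝ → ℝ
  Q_smooth : ∀ i, ContDiffOn ℝ ∞ (Q i) (Set.Ioi 0)

namespace Microgrid

variable {L I : Type*} [Fintype L] [DecidableEq L] [Fintype I] [DecidableEq I]

/-- The susceptance matrix: `B i j = - b i j` off the diagonal, `B i i = ∑_{j ≠ i} b i j`. -/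
def B (N : Microgrid L I) : Matrix (L ⊕ I) (L ⊕ I) ℝ :=
  Matrix.of fun i j => if i = j then ∑ k ∈ Finset.univ.erase i, N.b i k else - N.b i j

/-- `B_II + K_I`. -/
noncomputable def BIIK (N : Microgrid L I) : Matrix I I ℝ :=
  N.B.toBlocks₂₂ + Matrix.diagonal N.K

/-- The reduced susceptance matrix `B_LL - B_LI (B_II + K_I)⁻¹ B_IL`. -/
noncomputable def Bred (N : Microgrid L I) : Matrix L L ℝ :=
  N.B.toBlocks₁₁ - N.B.toBlocks₁₂ * N.BIIK⁻¹ * N.B.toBlocks₂₁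

/-- The averaging matrix `W₁ = - B_red⁻¹ B_LI (B_II + K_I)⁻¹ K_I`. -/
noncomputable def W₁ (N : Microgrid L I) : Matrix L I ℝ :=
  - (N.Bred⁻¹ * N.B.toBlocks₁₂ * N.BIIK⁻¹ * Matrix.diagonal N.K)

/-- The averaging matrix `W₂ = (B_II + K_I)⁻¹ (-B_IL  K_I)`. -/
noncomputable def W₂ (N : Microgrid L I) : Matrix I (L ⊕ I) ℝ :=
  N.BIIK⁻¹ * Matrix.fromCols (- N.B.toBlocks₂₁) (Matrix.diagonal N.K)

/-- The open-circuit load voltages `E_L^* = W₁ E_I^*`. -/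
noncomputable def ELopen (N : Microgrid L I) : L → ℝ := N.W₁ *ᵥ N.Eset

/-- The vector of load injections `Q_L(E_L) = (Q_i(E_i))_i`. -/
def QL (N : Microgrid L I) (EL : L → ℝ) : L → ℝ := fun i => N.Q i (EL i)

/-- The right-hand side `Q_L(E_L) + [E_L] B_red (E_L - E_L^*)` of the reduced power flow
equation. -/
noncomputable def reducedFlow (N : Microgrid L I) (EL : L → ℝ) : L → ℝ :=
  N.QL EL + Matrix.diagonal EL *ᵥ (N.Bred *ᵥ (EL - N.ELopen))

/-- The reduced Jacobian `∂Q_L/∂E_L (E_L) + [E_L] B_red + [B_red (E_L - E_L^*)]`. -/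
noncomputable def Jred (N : Microgrid L I) (EL : L → ℝ) : Matrix L L ℝ :=
  Matrix.diagonal (fun i => deriv (N.Q i) (EL i)) + Matrix.diagonal EL * N.Bred
    + Matrix.diagonal (N.Bred *ᵥ (EL - N.ELopen))

/-- The inverter voltages `E_I = W₂ (E_L, E_I^*)` recovered from the load voltages. -/
noncomputable def inverterVoltages (N : Microgrid L I) (EL : L → ℝ) : I → ℝ :=
  N.W₂ *ᵥ Sum.elim EL N.Eset

/-- The right-hand side `(Q_L(E_L), [E_I] K_I (E_I - E_I^*)) + [E] B E` of the closed-loop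
system. -/
def closedLoop (N : Microgrid L I) (E : L ⊕ I → ℝ) : L ⊕ I → ℝ :=
  Sum.elim (N.QL fun i => E (Sum.inl i))
      (fun i => E (Sum.inr i) * N.K i * (E (Sum.inr i) - N.Eset i))
    + Matrix.diagonal E *ᵥ (N.B *ᵥ E)

/-- Equilibrium points of the closed-loop system (in the space of positive voltages). -/
def IsEquilibrium (N : Microgrid L I) (E : L ⊕ I → ℝ) : Prop :=
  (∀ i, 0 < E i) ∧ N.closedLoop E = 0

/-- Consistent states: positive voltages that satisfy the algebraic (load) equations. -/
def IsConsistent (N : Microgrid L I) (E : L ⊕ I → ℝ) : Prop :=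
  (∀ i, 0 < E i) ∧ ∀ i : L, N.closedLoop E (Sum.inl i) = 0

/-- `E` solves the differential-algebraic closed-loop system `(0, τ_I Ė_I) = closedLoop E` on the
time interval `s`: it is continuous, stays consistent, and its inverter components are
differentiable and satisfy the differential equations. -/
structure IsSolutionOn (N : Microgrid L I) (s : Set ℝ) (E : ℝ → L ⊕ I → ℝ) : Prop where
  continuousOn : ContinuousOn E s
  consistent : ∀ t ∈ s, N.IsConsistent (E t)
  differential : ∀ t ∈ s, ∀ i : I, ∃ v : ℝ,
    HasDerivWithinAt (fun r => E r (Sum.inr i)) v s t ∧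
      N.τ i * v = N.closedLoop (E t) (Sum.inr i)

/-- Local exponential stability of an equilibrium `Ebar` of the differential-algebraic system: from
every consistent state close to `Ebar` starts a solution that exists for all times, and every
solution starting close to `Ebar` converges to it exponentially, as long as it is defined.
(The sup norm is used; all norms are equivalent here.) -/
def LocallyExponentiallyStable (N : Microgrid L I) (Ebar : L ⊕ I → ℝ) : Prop :=
  N.IsEquilibrium Ebar ∧
  ∃ δ > 0, ∃ C > 0, ∃ α > 0,
    (∀ E₀ : L ⊕ I → ℝ, N.IsConsistent E₀ → ‖E₀ - Ebar‖ < δ →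
      ∃ E : ℝ → L ⊕ I → ℝ, N.IsSolutionOn (Set.Ici 0) E ∧ E 0 = E₀) ∧
    ∀ (T : ℝ) (E : ℝ → L ⊕ I → ℝ), N.IsSolutionOn (Set.Icc 0 T) E → ‖E 0 - Ebar‖ < δ →
      ∀ t ∈ Set.Icc 0 T, ‖E t - Ebar‖ ≤ C * Real.exp (-α * t) * ‖E 0 - Ebar‖

end Microgrid

/-! At the equilibrium `p` the derivative of `closedLoop` is `diagonal p * M` with `M = N.shunted
(N.loadShunt EL)` symmetric: each load acts as a shunt susceptance, each inverter as its gain.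
Likewise `Jred` is `diagonal EL` times the Schur complement of the inverter block of `M`. A positive
diagonal matrix times a symmetric `S` is Hurwitz exactly when `-S` is positive definite, and the
inverter block of `-M` is always positive definite; hence `Jred` is Hurwitz iff `-M` is positive
definite (`isHurwitz_Jred_iff`).

Then V = ∑ (τ_i / p_i) (E_i - p_i)², summed over inverters only, is a Lyapunov function. On
consistent states the load equations vanish, so V̇/2 equals the sum of (E_i - p_i) F_i(E) / p_i over
all buses, F being `closedLoop`. With x = E - p this is xᵀMx + o(‖x‖²), which dissipates the load
deviations too (`exists_local_dissipation_algebraic`, `exists_decay`).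

For existence, definiteness of `-M` lets the algebraic equations be solved for the load voltages
near `p` (`exists_implicit_parametrization`). A locally Lipschitz ODE for the inverter voltages
remains, and the decay estimate keeps its solutions in the chart. -/

open Matrix

/-! ### Positive definite matrices and eigenvectors -/

namespace Matrix

variable {m n ι : Type*} [Fintype m] [Fintype n] [DecidableEq n]
  [Fintype ι]

/-- Positive definiteness of a real block matrix in terms of the Schur complement. -/
theorem posDef_fromBlocks_iff_schur {A : Matrix m m ℝ} {B : Matrix m n ℝ} {D : Matrix n n ℝ}
    (hD : D.PosDef) :
    (fromBlocks A B Bᴴ D).PosDef ↔ (A - B * D⁻¹ * Bᴴ).PosDef := by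
  have hDi : Invertible D := hD.isUnit.invertible
  have key := fun x y => schur_complement_eq₂₂ A B (D := D) x y hD.isHermitian
  simp only [← dotProduct_mulVec] at key
  constructor
  · intro h
    refine .of_dotProduct_mulVec_pos ((IsHermitian.fromBlocks₂₂ A B hD.isHermitian).1 h.1) ?_
    intro x hx
    -- The second component minimizes the form for fixed `x`: the completed square vanishes and only
    -- the Schur complement is left.
    have h1 := h.dotProduct_mulVec_pos (x := Sum.elim x (-((D⁻¹ * Bᴴ) *ᵥ x))) (fun h0 => hx (by
      funext i; simpa using congrFun h0 (Sum.inl i)))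
    rw [key] at h1
    simpa using h1
  · intro h
    refine .of_dotProduct_mulVec_pos ((IsHermitian.fromBlocks₂₂ A B hD.isHermitian).2 h.1) ?_
    intro z hz
    obtain ⟨x, y, rfl⟩ : ∃ x y, z = Sum.elim x y := ⟨z ∘ Sum.inl, z ∘ Sum.inr, by simp⟩
    rw [key]
    by_cases hx : x = 0
    · subst hx
      have hy : y ≠ 0 := fun hy => hz (by subst hy; simp)
      simpa using hD.dotProduct_mulVec_pos hy
    · exact add_pos_of_nonneg_of_pos (hD.posSemidef.dotProduct_mulVec_nonneg _)
        (h.dotProduct_mulVec_pos hx)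

/-- A positive definite quadratic form is coercive. -/
theorem PosDef.exists_coercive {P : Matrix ι ι ℝ} (hP : P.PosDef) :
    ∃ c > 0, ∀ x : ι → ℝ, c * ‖x‖ ^ 2 ≤ x ⬝ᵥ (P *ᵥ x) := by
  obtain hs | hs := (Metric.sphere (0 : ι → ℝ) 1).eq_empty_or_nonempty
  · refine ⟨1, one_pos, fun x => ?_⟩
    have : x = 0 := by
      by_contra hx
      have : (‖x‖⁻¹ • x) ∈ Metric.sphere (0 : ι → ℝ) 1 := by
        simp [norm_smul, norm_ne_zero_iff.2 hx]
      simp [hs] at this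
    simp [this]
  · have hc : Continuous fun x : ι → ℝ => x ⬝ᵥ (P *ᵥ x) := by fun_prop
    obtain ⟨x₀, hx₀, hmin⟩ := (isCompact_sphere (0 : ι → ℝ) 1).exists_isMinOn hs hc.continuousOn
    have hx₀' : x₀ ≠ 0 := by
      rintro rfl
      simp at hx₀
    refine ⟨x₀ ⬝ᵥ (P *ᵥ x₀), by simpa using hP.dotProduct_mulVec_pos hx₀', fun x => ?_⟩
    by_cases hx : x = 0
    · simp [hx]
    have hn : 0 < ‖x‖ := norm_pos_iff.2 hx
    have h1 := hmin (show (‖x‖⁻¹ • x) ∈ Metric.sphere (0 : ι → ℝ) 1 by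
      simp [norm_smul, hn.ne'])
    simp only [Set.mem_ofPred_eq, mulVec_smul, smul_dotProduct, dotProduct_smul, smul_eq_mul] at h1
    calc _ ≤ (‖x‖⁻¹ * (‖x‖⁻¹ * (x ⬝ᵥ (P *ᵥ x)))) * ‖x‖ ^ 2 := by gcongr
      _ = _ := by field_simp

theorem mem_spectrum_iff_exists_mulVec [DecidableEq ι] {K : Type*} [Field K] {A : Matrix ι ι K} {μ : K} :
    μ ∈ spectrum K A ↔ ∃ v ≠ 0, A *ᵥ v = μ • v := by
  rw [← spectrum_toLin', ← Module.End.hasEigenvalue_iff_mem_spectrum]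
  constructor
  · intro h
    obtain ⟨v, hv⟩ := h.exists_hasEigenvector
    exact ⟨v, hv.2, by simpa using hv.apply_eq_smul⟩
  · rintro ⟨v, hv, h⟩
    exact Module.End.hasEigenvalue_of_hasEigenvector
      (Module.End.hasEigenvector_iff.2 ⟨by simpa using h, hv⟩)

end Matrix

/-! ### Hurwitz criterion for a positive diagonal matrix times a symmetric matrix -/

section Hurwitz

variable {ι : Type*} [Fintype ι] [DecidableEq ι]

/-- An eigenvector v = x + iy satisfies v*Sv = μ v*D⁻¹v. Taking real parts gives xᵀSx + yᵀSy = Re μ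
· ∑ |v_i|² / d_i, with negative left-hand side. -/
theorem isHurwitz_diagonal_mul_of_neg_posDef {d : ι → ℝ} (hd : ∀ i, 0 < d i) {S : Matrix ι ι ℝ}
    (hS : (-S).PosDef) : IsHurwitz (diagonal d * S) := by
  intro μ hμ
  obtain ⟨v, hv, h⟩ := mem_spectrum_iff_exists_mulVec.1 hμ
  have hcomp : ∀ i, (d i : ℂ) * ((S.map Complex.ofReal) *ᵥ v) i = μ * v i := by
    intro i
    have := congrFun h i
    rw [show (diagonal d * S).map Complex.ofReal
        = diagonal (fun i => (d i : ℂ)) * S.map Complex.ofReal by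
      ext i j; simp] at this
    rw [← mulVec_mulVec, mulVec_diagonal] at this
    simpa using this
  set x : ι → ℝ := fun i => (v i).re
  set y : ι → ℝ := fun i => (v i).im
  have hre : ∀ i, d i * (S *ᵥ x) i = μ.re * x i - μ.im * y i := by
    intro i
    have := congrArg Complex.re (hcomp i)
    simpa [mulVec, dotProduct, Complex.re_sum, x, y] using this
  have him : ∀ i, d i * (S *ᵥ y) i = μ.re * y i + μ.im * x i := by
    intro i
    have := congrArg Complex.im (hcomp i)
    simpa [mulVec, dotProduct, Complex.im_sum, x, y] using this
  have hsum : x ⬝ᵥ (S *ᵥ x) + y ⬝ᵥ (S *ᵥ y) = μ.re * ∑ i, (x i ^ 2 + y i ^ 2) / d i := by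
    simp only [dotProduct, Finset.mul_sum, ← Finset.sum_add_distrib]
    refine Finset.sum_congr rfl fun i _ => ?_
    have := (hd i).ne'
    have h1 := hre i
    have h2 := him i
    field_simp
    linear_combination x i * h1 + y i * h2
  have hx0 : x ⬝ᵥ (S *ᵥ x) ≤ 0 := by
    simpa [neg_mulVec] using hS.posSemidef.dotProduct_mulVec_nonneg x
  have hy0 : y ⬝ᵥ (S *ᵥ y) ≤ 0 := by
    simpa [neg_mulVec] using hS.posSemidef.dotProduct_mulVec_nonneg y
  have hlt : x ⬝ᵥ (S *ᵥ x) + y ⬝ᵥ (S *ᵥ y) < 0 := by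
    by_cases hx : x = 0
    · have hy : y ≠ 0 := fun hy => hv (by
        funext i
        exact Complex.ext (congrFun hx i) (congrFun hy i))
      have : y ⬝ᵥ (S *ᵥ y) < 0 := by simpa [neg_mulVec] using hS.dotProduct_mulVec_pos hy
      linarith
    · have : x ⬝ᵥ (S *ᵥ x) < 0 := by simpa [neg_mulVec] using hS.dotProduct_mulVec_pos hx
      linarith
  have hs0 : 0 ≤ ∑ i, (x i ^ 2 + y i ^ 2) / d i :=
    Finset.sum_nonneg fun i _ => by have := hd i; positivity
  by_contra! hμ0
  rw [hsum] at hlt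
  exact absurd hlt (not_lt.2 (mul_nonneg hμ0 hs0))

/-- Conjugation by diag √d turns the matrix into the symmetric matrix diag √d · S · diag √d, so its
spectrum is real and the Hurwitz property fixes the sign of a quadratic form congruent to that of
`S`. -/
theorem neg_posDef_of_isHurwitz_diagonal_mul {d : ι → ℝ} (hd : ∀ i, 0 < d i) {S : Matrix ι ι ℝ}
    (hS : S.IsSymm) (h : IsHurwitz (diagonal d * S)) : (-S).PosDef := by
  set q : ι → ℝ := fun i => √(d i)
  have hq : ∀ i, 0 < q i := fun i => Real.sqrt_pos.2 (hd i)
  have hqq : ∀ i, q i * q i = d i := fun i => Real.mul_self_sqrt (hd i).le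
  set T : Matrix ι ι ℝ := diagonal q * (-S) * diagonal q with hT
  have hTH : T.IsHermitian := by
    ext i j
    have := congrFun (congrFun hS i) j
    simp only [transpose_apply] at this
    simp [hT, this]
    ring
  have hTpos : T.PosDef := by
    rw [hTH.posDef_iff_eigenvalues_pos]
    intro i
    set w : ι → ℝ := ⇑(hTH.eigenvectorBasis i) with hw
    have hw0 : w ≠ 0 := fun h0 => by
      have := hTH.eigenvectorBasis.orthonormal.ne_zero i
      exact this (by ext j; exact congrFun h0 j)
    have hTw : T *ᵥ w = hTH.eigenvalues i • w := hTH.mulVec_eigenvectorBasis i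
    generalize hTH.eigenvalues i = lam at hTw ⊢
    have hreal : (-lam) ∈ spectrum ℝ (diagonal d * S) := by
      refine mem_spectrum_iff_exists_mulVec.2 ⟨diagonal q *ᵥ w, fun h0 => hw0 ?_, ?_⟩
      · funext j
        have := congrFun h0 j
        simpa [mulVec_diagonal, (hq j).ne'] using this
      · funext j
        have h1 := congrFun hTw j
        rw [hT, ← mulVec_mulVec, ← mulVec_mulVec, mulVec_diagonal, neg_mulVec] at h1
        rw [← mulVec_mulVec, mulVec_diagonal]
        simp only [Pi.smul_apply, Pi.neg_apply, smul_eq_mul, mulVec_diagonal] at h1 ⊢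
        rw [← hqq]
        linear_combination - q j * h1
    have hcomplex : ((-lam : ℝ) : ℂ) ∈
        spectrum ℂ ((diagonal d * S).map Complex.ofReal) := by
      obtain ⟨v, hv, hv'⟩ := mem_spectrum_iff_exists_mulVec.1 hreal
      refine mem_spectrum_iff_exists_mulVec.2 ⟨fun j => (v j : ℂ), fun h0 => hv ?_, ?_⟩
      · funext j
        simpa using congrFun h0 j
      · funext j
        have := congrArg Complex.ofReal (congrFun hv' j)
        simpa [mulVec, dotProduct] using this
    have := h _ hcomplex
    simp only [Complex.ofReal_re] at this
    linarith
  refine .of_dotProduct_mulVec_pos (by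
    rw [IsHermitian, conjTranspose_eq_transpose_of_trivial, transpose_neg, hS.eq]) fun x hx => ?_
  have h1 := hTpos.dotProduct_mulVec_pos (x := fun i => (q i)⁻¹ * x i) (fun h0 => hx (by
    funext i
    simpa [(hq i).ne'] using congrFun h0 i))
  have h2 : diagonal q *ᵥ (fun i => (q i)⁻¹ * x i) = x := by
    funext i
    simp [mulVec_diagonal, (hq i).ne']
  rw [hT, ← mulVec_mulVec, ← mulVec_mulVec, h2] at h1
  convert h1 using 1
  simp only [dotProduct, mulVec_diagonal, star_trivial]
  refine Finset.sum_congr rfl fun i _ => ?_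
  have := (hq i).ne'
  field_simp

end Hurwitz

/-! ### Network matrices, equilibrium and linearization -/

namespace Microgrid

theorem b_nonpos {L I : Type*} (N : Microgrid L I) (i j : L ⊕ I) : N.b i j ≤ 0 := by
  by_cases h : N.graph.Adj i j
  · exact (N.b_neg i j h).le
  · exact (N.b_zero i j h).le

variable {L I : Type*} [Fintype L] [DecidableEq L] [Fintype I] [DecidableEq I]

theorem B_isSymm (N : Microgrid L I) : N.B.IsSymm := by
  ext i j
  by_cases h : i = j
  · subst h; rfl
  · simp [B, h, Ne.symm h, N.b_symm i j]

theorem B_mulVec_apply (N : Microgrid L I) (x : L ⊕ I → ℝ) (i : L ⊕ I) :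
    (N.B *ᵥ x) i = ∑ j, N.b i j * (x i - x j) := by
  have h0 : ∀ j, N.B i j * x j = (if i = j then (∑ k, N.b i k) * x i else 0) - N.b i j * x j := by
    intro j
    by_cases h : i = j
    · subst h
      have := Finset.add_sum_erase Finset.univ (N.b i) (Finset.mem_univ i)
      have hz := N.b_zero i i (N.graph.loopless.irrefl i)
      rw [hz, zero_add] at this
      simp [B, hz]
    · simp [B, h]
  simp only [mulVec, dotProduct, h0, Finset.sum_sub_distrib, mul_sub, ← Finset.sum_mul]
  simp

/-- Dirichlet energy of the network; the double sum meets each branch twice, whence the factor 1/2.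
-/
theorem dotProduct_B_mulVec (N : Microgrid L I) (x : L ⊕ I → ℝ) :
    x ⬝ᵥ (N.B *ᵥ x) = (∑ i, ∑ j, N.b i j * (x i - x j) ^ 2) / 2 := by
  have h1 : x ⬝ᵥ (N.B *ᵥ x) = ∑ i, ∑ j, N.b i j * (x i - x j) * x i := by
    simp only [dotProduct, B_mulVec_apply, Finset.mul_sum]
    exact Finset.sum_congr rfl fun i _ => Finset.sum_congr rfl fun j _ => by ring
  have h2 : x ⬝ᵥ (N.B *ᵥ x) = ∑ i, ∑ j, N.b i j * (x j - x i) * x j := by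
    rw [h1, Finset.sum_comm]
    exact Finset.sum_congr rfl fun i _ => Finset.sum_congr rfl fun j _ => by rw [N.b_symm]
  have h3 : ∑ i, ∑ j, N.b i j * (x i - x j) ^ 2 = x ⬝ᵥ (N.B *ᵥ x) + x ⬝ᵥ (N.B *ᵥ x) := by
    conv_rhs => rw [h1]
    conv_rhs => arg 2; rw [← h1, h2]
    simp only [← Finset.sum_add_distrib]
    exact Finset.sum_congr rfl fun i _ => Finset.sum_congr rfl fun j _ => by ring
  rw [h3]; ring

/-- The susceptance matrix with shunt susceptances `a` added at the loads and the gains `K` added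
at the inverters. -/
def shunted (N : Microgrid L I) (a : L → ℝ) : Matrix (L ⊕ I) (L ⊕ I) ℝ :=
  N.B + diagonal (Sum.elim a N.K)

theorem shunted_isSymm (N : Microgrid L I) (a : L → ℝ) : (N.shunted a).IsSymm :=
  N.B_isSymm.add (isSymm_diagonal _)

/-- Vanishing energy makes `x` constant along branches, hence constant by connectedness, and a
single nonzero gain forces that constant to be zero. -/
theorem neg_shunted_zero_posDef [Nonempty I] (N : Microgrid L I) : (-N.shunted 0).PosDef := by
  refine .of_dotProduct_mulVec_pos (by
    rw [IsHermitian, conjTranspose_eq_transpose_of_trivial, transpose_neg,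
      (N.shunted_isSymm 0).eq]) fun x hx => ?_
  have hK : x ⬝ᵥ (diagonal (Sum.elim 0 N.K) *ᵥ x) = ∑ i : I, N.K i * x (Sum.inr i) ^ 2 := by
    simp only [dotProduct, mulVec_diagonal, Fintype.sum_sum_type]
    simp
    exact Finset.sum_congr rfl fun i _ => by ring
  have hb : ∀ i j, N.b i j * (x i - x j) ^ 2 ≤ 0 := fun i j =>
    mul_nonpos_of_nonpos_of_nonneg (N.b_nonpos i j) (sq_nonneg _)
  have hb' : ∀ i, ∑ j, N.b i j * (x i - x j) ^ 2 ≤ 0 := fun i =>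
    Finset.sum_nonpos fun j _ => hb i j
  have hk : ∀ i : I, N.K i * x (Sum.inr i) ^ 2 ≤ 0 := fun i =>
    mul_nonpos_of_nonpos_of_nonneg (N.K_neg i).le (sq_nonneg _)
  have hbs := Finset.sum_nonpos fun i (_ : i ∈ Finset.univ) => hb' i
  have hks := Finset.sum_nonpos fun i (_ : i ∈ Finset.univ) => hk i
  rw [star_trivial, neg_mulVec, dotProduct_neg, shunted, add_mulVec, dotProduct_add, hK,
    dotProduct_B_mulVec]
  by_contra! hle
  have e1 : ∑ i, ∑ j, N.b i j * (x i - x j) ^ 2 = 0 := by linarith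
  have e2 : ∑ i : I, N.K i * x (Sum.inr i) ^ 2 = 0 := by linarith
  rw [Finset.sum_eq_zero_iff_of_nonpos fun i _ => hb' i] at e1
  rw [Finset.sum_eq_zero_iff_of_nonpos fun i _ => hk i] at e2
  have hadj : ∀ i j, N.graph.Adj i j → x i = x j := by
    intro i j hij
    have := (Finset.sum_eq_zero_iff_of_nonpos fun j _ => hb i j).1 (e1 i (Finset.mem_univ i)) j
      (Finset.mem_univ j)
    simpa [(N.b_neg i j hij).ne, sub_eq_zero] using this
  have hconst : ∀ i j, x i = x j := by
    intro i j
    obtain ⟨p⟩ := N.connected.preconnected i j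
    induction p with
    | nil => rfl
    | cons h _ ih => exact (hadj _ _ h).trans ih
  obtain ⟨k⟩ := ‹Nonempty I›
  have hk0 : x (Sum.inr k) = 0 := by
    have := e2 k (Finset.mem_univ k)
    simpa [(N.K_neg k).ne] using this
  exact hx (funext fun i => (hconst i _).trans hk0)

theorem neg_BIIK_posDef [Nonempty I] (N : Microgrid L I) : (-N.BIIK).PosDef := by
  convert N.neg_shunted_zero_posDef.submatrix (Sum.inr_injective (α := L)) using 1
  ext i j
  by_cases h : i = j <;> simp [BIIK, shunted, toBlocks₂₂, h]

theorem BIIK_isUnit_det [Nonempty I] (N : Microgrid L I) : IsUnit N.BIIK.det := by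
  have := N.neg_BIIK_posDef.isUnit
  rw [IsUnit.neg_iff] at this
  exact (isUnit_iff_isUnit_det _).1 this

/-- The shunts `a` enter only the load block, so eliminating the inverters yields `Bred + diagonal
a`. Taking `a = 0` gives invertibility and symmetry of `Bred`; taking `a = loadShunt` gives the
stability criterion. -/
theorem neg_shunted_posDef_iff [Nonempty I] (N : Microgrid L I) (a : L → ℝ) :
    (-N.shunted a).PosDef ↔ (-(N.Bred + diagonal a)).PosDef := by
  have h := posDef_fromBlocks_iff_schur (A := -(N.B.toBlocks₁₁ + diagonal a))
    (B := -N.B.toBlocks₁₂) N.neg_BIIK_posDef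
  have hs : (-N.B.toBlocks₁₂)ᴴ = -N.B.toBlocks₂₁ := by
    ext i j
    simpa [toBlocks₁₂, toBlocks₂₁] using N.B_isSymm.apply (Sum.inr i) (Sum.inl j)
  rw [hs] at h
  have h1 : fromBlocks (-(N.B.toBlocks₁₁ + diagonal a)) (-N.B.toBlocks₁₂) (-N.B.toBlocks₂₁)
      (-N.BIIK) = -N.shunted a := by
    rw [← fromBlocks_neg, shunted, ← fromBlocks_diagonal, BIIK]
    conv_rhs => rw [← fromBlocks_toBlocks N.B, fromBlocks_add]
    simp
  have h2 : -(N.B.toBlocks₁₁ + diagonal a) - -N.B.toBlocks₁₂ * (-N.BIIK)⁻¹ * -N.B.toBlocks₂₁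
      = -(N.Bred + diagonal a) := by
    have : (-N.BIIK)⁻¹ = -N.BIIK⁻¹ := by
      refine inv_eq_left_inv ?_
      rw [neg_mul_neg, nonsing_inv_mul _ N.BIIK_isUnit_det]
    rw [this, Bred]
    simp only [Matrix.neg_mul, Matrix.mul_neg, neg_neg]
    abel
  rw [h1, h2] at h
  exact h

theorem Bred_isUnit_det [Nonempty I] (N : Microgrid L I) : IsUnit N.Bred.det := by
  have := ((N.neg_shunted_posDef_iff 0).1 N.neg_shunted_zero_posDef).isUnit
  rw [IsUnit.neg_iff, diagonal_zero', add_zero] at this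
  exact (isUnit_iff_isUnit_det _).1 this

theorem Bred_isSymm [Nonempty I] (N : Microgrid L I) : N.Bred.IsSymm := by
  have := ((N.neg_shunted_posDef_iff 0).1 N.neg_shunted_zero_posDef).isHermitian.neg
  rw [neg_neg, diagonal_zero', add_zero] at this
  rwa [IsHermitian, conjTranspose_eq_transpose_of_trivial] at this

/-- The voltage profile with load voltages `EL` and the corresponding inverter voltages. -/
noncomputable def profile (N : Microgrid L I) (EL : L → ℝ) : L ⊕ I → ℝ :=
  Sum.elim EL (N.inverterVoltages EL)

theorem B_mulVec_sumElim (N : Microgrid L I) (x : L → ℝ) (y : I → ℝ) :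
    N.B *ᵥ Sum.elim x y = Sum.elim (N.B.toBlocks₁₁ *ᵥ x + N.B.toBlocks₁₂ *ᵥ y)
      (N.B.toBlocks₂₁ *ᵥ x + N.B.toBlocks₂₂ *ᵥ y) := by
  conv_lhs => rw [← fromBlocks_toBlocks N.B]
  rw [fromBlocks_mulVec]
  simp

theorem inverterVoltages_eq (N : Microgrid L I) (EL : L → ℝ) :
    N.inverterVoltages EL
      = N.BIIK⁻¹ *ᵥ (diagonal N.K *ᵥ N.Eset) - N.BIIK⁻¹ *ᵥ (N.B.toBlocks₂₁ *ᵥ EL) := by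
  rw [inverterVoltages, W₂, ← mulVec_mulVec, fromCols_mulVec_sumElim, mulVec_add, neg_mulVec,
    mulVec_neg]
  abel

theorem B_mulVec_profile_inr [Nonempty I] (N : Microgrid L I) (EL : L → ℝ) (i : I) :
    (N.B *ᵥ N.profile EL) (Sum.inr i) = -(N.K i * (N.profile EL (Sum.inr i) - N.Eset i)) := by
  have h : N.BIIK *ᵥ N.inverterVoltages EL
      = diagonal N.K *ᵥ N.Eset - N.B.toBlocks₂₁ *ᵥ EL := by
    rw [inverterVoltages_eq, mulVec_sub, mulVec_mulVec _ N.BIIK, mulVec_mulVec _ N.BIIK,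
      mul_nonsing_inv _ N.BIIK_isUnit_det, one_mulVec, one_mulVec]
  have := congrFun h i
  rw [BIIK, add_mulVec] at this
  rw [profile, B_mulVec_sumElim]
  simp only [Pi.add_apply, Pi.sub_apply, mulVec_diagonal, Sum.elim_inr] at this ⊢
  linarith

theorem B_mulVec_profile_inl [Nonempty I] (N : Microgrid L I) (EL : L → ℝ) (i : L) :
    (N.B *ᵥ N.profile EL) (Sum.inl i) = (N.Bred *ᵥ (EL - N.ELopen)) i := by
  have h : N.Bred *ᵥ N.ELopen
      = -(N.B.toBlocks₁₂ *ᵥ (N.BIIK⁻¹ *ᵥ (diagonal N.K *ᵥ N.Eset))) := by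
    rw [ELopen, W₁, neg_mulVec, mulVec_neg]
    simp only [← mulVec_mulVec]
    rw [mulVec_mulVec, mul_nonsing_inv _ N.Bred_isUnit_det, one_mulVec]
  rw [profile, B_mulVec_sumElim, mulVec_sub, h, inverterVoltages_eq, mulVec_sub, Bred, sub_mulVec]
  simp only [← mulVec_mulVec, Sum.elim_inl, Pi.add_apply, Pi.sub_apply, Pi.neg_apply]
  ring

theorem closedLoop_inl (N : Microgrid L I) (E : L ⊕ I → ℝ) (i : L) :
    N.closedLoop E (Sum.inl i) = N.Q i (E (Sum.inl i)) + E (Sum.inl i) * (N.B *ᵥ E) (Sum.inl i) := by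
  simp [closedLoop, QL, mulVec_diagonal, -mulVec_mulVec]

theorem closedLoop_inr (N : Microgrid L I) (E : L ⊕ I → ℝ) (i : I) :
    N.closedLoop E (Sum.inr i)
      = E (Sum.inr i) * (N.K i * (E (Sum.inr i) - N.Eset i) + (N.B *ᵥ E) (Sum.inr i)) := by
  simp [closedLoop, mulVec_diagonal, -mulVec_mulVec]
  ring

theorem reducedFlow_apply (N : Microgrid L I) (EL : L → ℝ) (i : L) :
    N.reducedFlow EL i = N.Q i (EL i) + EL i * (N.Bred *ᵥ (EL - N.ELopen)) i := by
  simp [reducedFlow, QL, mulVec_diagonal, -mulVec_mulVec]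

/-- Minimum principle: at an inverter `k` of least voltage, if that voltage were nonpositive, all
its neighbours would be at least as high, so (BE)_k ≥ 0. But (BE)_k = -K_k (E_k - E_k^*) < 0. -/
theorem profile_pos [Nonempty I] (N : Microgrid L I) {EL : L → ℝ} (hpos : ∀ i, 0 < EL i)
    (i : L ⊕ I) : 0 < N.profile EL i := by
  obtain ⟨k, hk⟩ := Finite.exists_min fun i : I => N.profile EL (Sum.inr i)
  have hk0 : 0 < N.profile EL (Sum.inr k) := by
    by_contra! hle
    have h1 := N.B_mulVec_profile_inr EL k
    rw [B_mulVec_apply] at h1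
    have h2 : 0 ≤ ∑ j, N.b (Sum.inr k) j * (N.profile EL (Sum.inr k) - N.profile EL j) := by
      refine Finset.sum_nonneg fun j _ => mul_nonneg_of_nonpos_of_nonpos (N.b_nonpos _ _) ?_
      rcases j with j | j
      · have := hpos j
        simp only [profile, Sum.elim_inl] at hle ⊢
        linarith
      · linarith [hk j]
    nlinarith [N.K_neg k, N.Eset_pos k]
  rcases i with i | i
  · exact hpos i
  · exact hk0.trans_le (hk i)

theorem profile_isEquilibrium [Nonempty I] (N : Microgrid L I) {EL : L → ℝ}
    (hpos : ∀ i, 0 < EL i) (hsol : N.reducedFlow EL = 0) : N.IsEquilibrium (N.profile EL) := by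
  refine ⟨N.profile_pos hpos, funext fun i => ?_⟩
  rcases i with i | i
  · rw [closedLoop_inl, B_mulVec_profile_inl]
    have := congrFun hsol i
    rwa [reducedFlow_apply] at this
  · rw [closedLoop_inr, B_mulVec_profile_inr]
    simp

/-- The shunt susceptances `(Q_i'(E_i) + (B_red (E_L - E_L^*))_i) / E_i` to which the loads are
equivalent in the linearization at `EL`. -/
noncomputable def loadShunt (N : Microgrid L I) (EL : L → ℝ) : L → ℝ := fun i =>
  (deriv (N.Q i) (EL i) + (N.Bred *ᵥ (EL - N.ELopen)) i) / EL i

theorem Jred_eq_diagonal_mul (N : Microgrid L I) {EL : L → ℝ} (hpos : ∀ i, 0 < EL i) :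
    N.Jred EL = diagonal EL * (N.Bred + diagonal (N.loadShunt EL)) := by
  rw [mul_add, diagonal_mul_diagonal, Jred, add_right_comm, diagonal_add, add_comm]
  congr 2
  funext i
  have := (hpos i).ne'
  simp only [loadShunt]
  field_simp

theorem isHurwitz_Jred_iff [Nonempty I] (N : Microgrid L I) {EL : L → ℝ}
    (hpos : ∀ i, 0 < EL i) :
    IsHurwitz (N.Jred EL) ↔ (-N.shunted (N.loadShunt EL)).PosDef := by
  rw [neg_shunted_posDef_iff, Jred_eq_diagonal_mul N hpos]
  exact ⟨neg_posDef_of_isHurwitz_diagonal_mul hpos (N.Bred_isSymm.add (isSymm_diagonal _)),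
    isHurwitz_diagonal_mul_of_neg_posDef hpos⟩

/-- The power flow equation gives (B_red (E_L - E_L^*))_i = -Q_i / E_i. Hence the equivalent shunt
is Q_i' / E_i - Q_i / E_i², whose first term only helps when Q_i' ≤ 0. -/
theorem isHurwitz_Jred_of_posDef (N : Microgrid L I) {EL : L → ℝ}
    (hpos : ∀ i, 0 < EL i) (hsol : N.reducedFlow EL = 0) (hQ : ∀ i, deriv (N.Q i) (EL i) ≤ 0)
    (h : (diagonal (fun i => N.QL EL i / EL i ^ 2) - N.Bred).PosDef) :
    IsHurwitz (N.Jred EL) := by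
  rw [Jred_eq_diagonal_mul N hpos]
  refine isHurwitz_diagonal_mul_of_neg_posDef hpos ?_
  have hd : -(N.Bred + diagonal (N.loadShunt EL))
      = (diagonal (fun i => N.QL EL i / EL i ^ 2) - N.Bred)
        + diagonal (fun i => -deriv (N.Q i) (EL i) / EL i) := by
    have : N.loadShunt EL
        = fun i => -(N.QL EL i / EL i ^ 2 + -deriv (N.Q i) (EL i) / EL i) := by
      funext i
      have h0 := (hpos i).ne'
      have h1 := congrFun hsol i
      rw [reducedFlow_apply, Pi.zero_apply] at h1
      simp only [loadShunt, QL]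
      field_simp
      linear_combination h1
    rw [this, sub_add_eq_add_sub, diagonal_add, neg_add, sub_eq_add_neg, add_comm]
    congr 1
    ext i j
    by_cases hij : i = j <;> simp [hij]
  rw [hd]
  exact h.add_posSemidef (.diagonal fun i =>
    div_nonneg (neg_nonneg.2 (hQ i)) (hpos i).le)

theorem hasStrictDerivAt_Q {L I : Type*} (N : Microgrid L I) (i : L) {x : ℝ} (hx : 0 < x) :
    HasStrictDerivAt (N.Q i) (deriv (N.Q i) x) x :=
  ((N.Q_smooth i).contDiffAt (Ioi_mem_nhds hx)).hasStrictDerivAt (by simp)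

theorem hasFDerivAt_reducedFlow (N : Microgrid L I) {EL : L → ℝ} (hpos : ∀ i, 0 < EL i) :
    HasFDerivAt N.reducedFlow (toLin' (N.Jred EL)).toContinuousLinearMap EL := by
  rw [hasFDerivAt_pi']
  intro i
  have hp : HasFDerivAt (fun E : L → ℝ => E i)
      (ContinuousLinearMap.proj (R := ℝ) (φ := fun _ : L => ℝ) i) EL :=
    (ContinuousLinearMap.proj (R := ℝ) (φ := fun _ : L => ℝ) i).hasFDerivAt
  have hq := (N.hasStrictDerivAt_Q i (hpos i)).hasDerivAt.comp_hasFDerivAt EL hp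
  have hB : HasFDerivAt (fun E : L → ℝ => (N.Bred *ᵥ (E - N.ELopen)) i)
      ((ContinuousLinearMap.proj (R := ℝ) (φ := fun _ : L => ℝ) i).comp
        (toLin' N.Bred).toContinuousLinearMap) EL := by
    have h := ((ContinuousLinearMap.proj (R := ℝ) (φ := fun _ : L => ℝ) i).comp
        (toLin' N.Bred).toContinuousLinearMap).hasFDerivAt (x := EL)
      |>.sub_const ((N.Bred *ᵥ N.ELopen) i)
    refine h.congr_of_eventuallyEq (.of_forall fun E => ?_)
    simp [mulVec_sub]
  have h := hq.add (hp.mul hB)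
  refine (h.congr_of_eventuallyEq (.of_forall fun E => ?_)).congr_fderiv ?_
  · simp [reducedFlow_apply]
  · ext v
    simp [Jred, mulVec_diagonal, -mulVec_mulVec]
    ring

/-- In the inverter rows the factor multiplying E_i vanishes at the profile, so only E_i times its
derivative survives; in the load rows `loadShunt` collects the diagonal terms. Strict
differentiability is what the inverse function theorem and the local Lipschitz bounds need. -/
theorem hasStrictFDerivAt_closedLoop [Nonempty I] (N : Microgrid L I) {EL : L → ℝ}
    (hpos : ∀ i, 0 < EL i) :
    HasStrictFDerivAt N.closedLoop (toLin'
      (diagonal (N.profile EL) * N.shunted (N.loadShunt EL))).toContinuousLinearMap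
      (N.profile EL) := by
  rw [hasStrictFDerivAt_pi']
  intro i
  set P := fun i => ContinuousLinearMap.proj (R := ℝ) (φ := fun _ : L ⊕ I => ℝ) i with hP
  have hp : ∀ i, HasStrictFDerivAt (fun E : L ⊕ I → ℝ => E i) (P i) (N.profile EL) :=
    fun i => (P i).hasStrictFDerivAt
  have hB : HasStrictFDerivAt (fun E : L ⊕ I → ℝ => (N.B *ᵥ E) i)
      ((P i).comp (toLin' N.B).toContinuousLinearMap) (N.profile EL) :=
    ((P i).comp (toLin' N.B).toContinuousLinearMap).hasStrictFDerivAt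
  rcases i with i | i
  · have hq := (N.hasStrictDerivAt_Q i (hpos i)).comp_hasStrictFDerivAt (N.profile EL)
      (hp (Sum.inl i))
    have h := hq.add ((hp (Sum.inl i)).mul hB)
    refine (h.congr_of_eventuallyEq (.of_forall fun E => ?_)).congr_fderiv ?_
    · simp [closedLoop_inl]
    · ext v
      have h0 := (hpos i).ne'
      simp [shunted, mulVec_diagonal, -mulVec_mulVec, B_mulVec_profile_inl, hP,
        loadShunt, -mulVec_single, mul_add]
      simp only [profile, Sum.elim_inl]
      field_simp
      ring
  · have hk := ((hp (Sum.inr i)).sub_const (N.Eset i)).const_mul (N.K i)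
    have h := (hp (Sum.inr i)).mul (hk.add hB)
    refine (h.congr_of_eventuallyEq (.of_forall fun E => ?_)).congr_fderiv ?_
    · simp [closedLoop_inr]
    · ext v
      simp [shunted, mulVec_diagonal, -mulVec_mulVec, B_mulVec_profile_inr, hP,
        -mulVec_single]
      ring

end Microgrid

/-! ### Trapping and local dissipation estimates -/

/-- Continuity induction for a trapping bound. -/
theorem ContinuousOn.forall_lt_of_trapping {f : ℝ → ℝ} {T r : ℝ} (hf : ContinuousOn f (Set.Icc 0 T))
    (h0 : f 0 ≤ r) (h : ∀ t ∈ Set.Icc 0 T, (∀ s ∈ Set.Icc 0 t, f s ≤ r) → f t < r) :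
    ∀ t ∈ Set.Icc 0 T, f t < r := by
  by_contra! hcon
  obtain ⟨t₀, ht₀, hft₀⟩ := hcon
  have hcl : IsClosed (Set.Icc 0 T ∩ f ⁻¹' Set.Ici r) :=
    hf.preimage_isClosed_of_isClosed isClosed_Icc isClosed_Ici
  have hcomp : IsCompact (Set.Icc 0 T ∩ f ⁻¹' Set.Ici r) :=
    isCompact_Icc.of_isClosed_subset hcl Set.inter_subset_left
  -- At the first time `t₁` with `r ≤ f t₁`, the intermediate value theorem forces equality, while
  -- `f ≤ r` up to `t₁`; the hypothesis then contradicts this.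
  obtain ⟨t₁, ⟨ht₁, hft₁⟩, hmin⟩ := hcomp.exists_isLeast ⟨t₀, ht₀, hft₀⟩
  obtain ⟨t₂, ht₂, hft₂⟩ := intermediate_value_Icc ht₁.1
    (hf.mono (Set.Icc_subset_Icc_right ht₁.2)) ⟨h0, hft₁⟩
  have h12 : t₁ ≤ t₂ := hmin ⟨⟨ht₂.1, ht₂.2.trans ht₁.2⟩, hft₂.ge⟩
  obtain rfl : t₁ = t₂ := le_antisymm h12 ht₂.2
  refine absurd hft₂ (h t₁ ht₁ fun s hs => ?_).ne
  by_contra! hlt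
  have := hmin ⟨⟨hs.1, hs.2.trans ht₁.2⟩, hlt.le⟩
  rw [le_antisymm hs.2 this] at hlt
  exact absurd hft₂ hlt.ne'

/-- The weights 1 / p_i cancel the factor `diagonal p`, leaving the form of `M` plus a remainder of
order o(‖x‖²) that costs at most half of the coercivity constant. -/
theorem exists_local_dissipation {ι : Type*} [Fintype ι] [DecidableEq ι] {F : (ι → ℝ) → ι → ℝ}
    {p : ι → ℝ} {M : Matrix ι ι ℝ} (hp : ∀ i, 0 < p i) (hM : (-M).PosDef) (hFp : F p = 0)
    (hF : HasFDerivAt F (toLin' (diagonal p * M)).toContinuousLinearMap p) :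
    ∃ r > 0, ∃ c > 0, ∀ E, ‖E - p‖ ≤ r →
      ∑ i, (E i - p i) * (F E i / p i) ≤ -c * ‖E - p‖ ^ 2 := by
  obtain ⟨c, hc, hcM⟩ := hM.exists_coercive
  set s := ∑ i, (p i)⁻¹ with hs
  have hs0 : 0 ≤ s := Finset.sum_nonneg fun i _ => (inv_pos.2 (hp i)).le
  set ε := c / (2 * (s + 1)) with hε
  have hε0 : 0 < ε := by positivity
  have hεs : ε * s ≤ c / 2 := by
    rw [hε, div_mul_eq_mul_div, div_le_div_iff₀ (by positivity) two_pos]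
    nlinarith
  have hlo := hF.isLittleO.def hε0
  obtain ⟨r, hr, hball⟩ := Metric.eventually_nhds_iff_ball.1 hlo
  refine ⟨r / 2, by positivity, c / 2, by positivity, fun E hE => ?_⟩
  have hEr := hball E (by rw [mem_ball_iff_norm]; linarith)
  simp only [hFp, sub_zero] at hEr
  set x := E - p with hx
  set R : ι → ℝ := F E - (toLin' (diagonal p * M)).toContinuousLinearMap x with hR
  have hsplit : ∀ i, (E i - p i) * (F E i / p i) = x i * (M *ᵥ x) i + x i * (R i * (p i)⁻¹) := by
    intro i
    have h0 := (hp i).ne'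
    have : R i = F E i - p i * (M *ᵥ x) i := by
      simp only [hR, Pi.sub_apply, LinearMap.coe_toContinuousLinearMap', toLin'_apply,
        ← mulVec_mulVec, mulVec_diagonal]
    rw [this, hx, Pi.sub_apply]
    field_simp
    ring
  have hbound : ∀ i, x i * (R i * (p i)⁻¹) ≤ ‖x‖ * (ε * ‖x‖ * (p i)⁻¹) := by
    intro i
    have hi := (inv_pos.2 (hp i)).le
    calc x i * (R i * (p i)⁻¹) ≤ |x i| * (|R i| * (p i)⁻¹) := by
          refine (le_abs_self _).trans ?_
          rw [abs_mul, abs_mul, abs_of_nonneg hi]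
      _ ≤ ‖x‖ * (ε * ‖x‖ * (p i)⁻¹) := by
          gcongr
          · exact norm_le_pi_norm x i
          · exact (norm_le_pi_norm R i).trans hEr
  have hMx : ∑ i, x i * (M *ᵥ x) i ≤ -(c * ‖x‖ ^ 2) := by
    have := hcM x
    rw [neg_mulVec, dotProduct_neg] at this
    simp only [dotProduct] at this
    linarith
  calc ∑ i, (E i - p i) * (F E i / p i)
      = ∑ i, x i * (M *ᵥ x) i + ∑ i, x i * (R i * (p i)⁻¹) := by
        rw [← Finset.sum_add_distrib]; exact Finset.sum_congr rfl fun i _ => hsplit i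
    _ ≤ -(c * ‖x‖ ^ 2) + ∑ i, ‖x‖ * (ε * ‖x‖ * (p i)⁻¹) := by
        exact add_le_add hMx (Finset.sum_le_sum fun i _ => hbound i)
    _ = -(c * ‖x‖ ^ 2) + (ε * s) * ‖x‖ ^ 2 := by
        rw [hs, Finset.mul_sum, Finset.sum_mul]
        congr 1
        exact Finset.sum_congr rfl fun i _ => by ring
    _ ≤ -(c * ‖x‖ ^ 2) + c / 2 * ‖x‖ ^ 2 := by gcongr
    _ = _ := by ring

/-- On the states with vanishing algebraic residual, the differential part dissipates, and the
deviation is controlled by the deviation of the differential variables. -/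
theorem exists_local_dissipation_algebraic {L I : Type*} [Fintype L] [DecidableEq L] [Fintype I]
    [DecidableEq I] {F : (L ⊕ I → ℝ) → L ⊕ I → ℝ} {p : L ⊕ I → ℝ}
    {M : Matrix (L ⊕ I) (L ⊕ I) ℝ} (hp : ∀ i, 0 < p i) (hM : (-M).PosDef) (hFp : F p = 0)
    (hF : HasFDerivAt F (toLin' (diagonal p * M)).toContinuousLinearMap p) :
    ∃ r > 0, ∃ c > 0, ∃ C > 0, ∀ E, ‖E - p‖ ≤ r → (∀ i, F E (Sum.inl i) = 0) →
      ∑ i, (E (Sum.inr i) - p (Sum.inr i)) * (F E (Sum.inr i) / p (Sum.inr i))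
        ≤ -c * ‖E - p‖ ^ 2 ∧
      ‖E - p‖ ≤ C * ‖fun i => E (Sum.inr i) - p (Sum.inr i)‖ := by
  obtain ⟨r₁, hr₁, c, hc, h₁⟩ := exists_local_dissipation hp hM hFp hF
  obtain ⟨K, hK, hbig⟩ := hF.isBigO_sub.exists_pos
  obtain ⟨r₂, hr₂, h₂⟩ := Metric.eventually_nhds_iff_ball.1 hbig.bound
  have hs0 : 0 ≤ ∑ i : I, (p (Sum.inr i))⁻¹ :=
    Finset.sum_nonneg fun i _ => (inv_pos.2 (hp _)).le
  set s := ∑ i : I, (p (Sum.inr i))⁻¹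
  refine ⟨min r₁ (r₂ / 2), by positivity, c, hc, K * (s + 1) / c, by positivity,
    fun E hE hEL => ?_⟩
  have hd := h₁ E (hE.trans (min_le_left _ _))
  rw [Fintype.sum_sum_type] at hd
  -- The load terms vanish on the constraint set, yet the right-hand side still has the full
  -- deviation.
  simp only [hEL, zero_div, mul_zero, Finset.sum_const_zero, zero_add] at hd
  refine ⟨hd, ?_⟩
  have hFE := h₂ E (by
    rw [mem_ball_iff_norm]; linarith [hE.trans (min_le_right _ _)])
  rw [hFp, sub_zero] at hFE
  set y : I → ℝ := fun i => E (Sum.inr i) - p (Sum.inr i) with hy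
  have hlow : ∑ i, -(‖y‖ * (K * ‖E - p‖ * (p (Sum.inr i))⁻¹))
      ≤ ∑ i, y i * (F E (Sum.inr i) / p (Sum.inr i)) := by
    refine Finset.sum_le_sum fun i _ => ?_
    have hi := (inv_pos.2 (hp (Sum.inr i))).le
    refine (neg_le_neg ?_).trans (neg_abs_le _)
    rw [abs_mul, div_eq_mul_inv, abs_mul, abs_of_nonneg hi]
    gcongr
    · exact norm_le_pi_norm y i
    · exact (norm_le_pi_norm (F E) (Sum.inr i)).trans hFE
  have hsum : ∑ i, -(‖y‖ * (K * ‖E - p‖ * (p (Sum.inr i))⁻¹)) = -(‖y‖ * K * ‖E - p‖ * s) := by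
    rw [Finset.sum_neg_distrib, Finset.mul_sum]
    congr 1
    exact Finset.sum_congr rfl fun i _ => by ring
  rw [hsum] at hlow
  obtain h0 | h0 := (norm_nonneg (E - p)).eq_or_lt
  · rw [← h0]; positivity
  rw [div_mul_eq_mul_div, le_div_iff₀ hc]
  -- Dissipation from below, the linear bound on `F` from above: cancelling one factor ‖E - p‖
  -- bounds the full deviation by the inverter part `y`, without an implicit function.
  have h3 : c * ‖E - p‖ ^ 2 ≤ ‖y‖ * K * ‖E - p‖ * s := by linarith
  have h4 : c * ‖E - p‖ ≤ ‖y‖ * K * s := by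
    refine le_of_mul_le_mul_right ?_ h0
    linarith
  nlinarith [mul_nonneg (norm_nonneg y) hK.le]

/-! ### Lyapunov function and exponential decay -/

namespace Microgrid

variable {L I : Type*} [Fintype L] [DecidableEq L] [Fintype I] [DecidableEq I]

theorem IsSolutionOn.mono {N : Microgrid L I} {s t : Set ℝ} {E : ℝ → L ⊕ I → ℝ}
    (h : N.IsSolutionOn t E) (hst : s ⊆ t) : N.IsSolutionOn s E where
  continuousOn := h.continuousOn.mono hst
  consistent r hr := h.consistent r (hst hr)
  differential r hr i := by
    obtain ⟨v, hv, hv'⟩ := h.differential r (hst hr) i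
    exact ⟨v, hv.mono hst, hv'⟩

/-- Exponential decay of solutions that stay close to a dissipative equilibrium. -/
theorem exists_decay_of_mem_ball [Nonempty I] (N : Microgrid L I) {p : L ⊕ I → ℝ}
    {M : Matrix (L ⊕ I) (L ⊕ I) ℝ} (hp : N.IsEquilibrium p) (hM : (-M).PosDef)
    (hF : HasFDerivAt N.closedLoop (toLin' (diagonal p * M)).toContinuousLinearMap p) :
    ∃ r > 0, ∃ C > 0, ∃ α > 0, ∀ T (E : ℝ → L ⊕ I → ℝ), N.IsSolutionOn (Set.Icc 0 T) E →
      (∀ t ∈ Set.Icc 0 T, ‖E t - p‖ ≤ r) →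
      ∀ t ∈ Set.Icc 0 T, ‖E t - p‖ ≤ C * Real.exp (-α * t) * ‖E 0 - p‖ := by
  obtain ⟨r, hr, c, hc, C, hC, h⟩ := exists_local_dissipation_algebraic hp.1 hM hp.2 hF
  -- With these weights the time constants cancel in the derivative of `V`, leaving the dissipation
  -- sum.
  set w : I → ℝ := fun i => N.τ i / p (Sum.inr i) with hw
  have hw0 : ∀ i, 0 < w i := fun i => div_pos (N.τ_pos i) (hp.1 _)
  obtain ⟨c₁, hc₁, hcoer⟩ := (PosDef.diagonal hw0).exists_coercive
  set W := ∑ i, w i with hW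
  have hW0 : 0 < W := Finset.sum_pos (fun i _ => hw0 i) Finset.univ_nonempty
  set α := c / W with hα
  have hα0 : 0 < α := by positivity
  refine ⟨r, hr, C * √(W / c₁), by positivity, α, hα0, fun T E hE hball t ht => ?_⟩
  have hT : 0 ≤ T := ht.1.trans ht.2
  set y : ℝ → I → ℝ := fun t i => E t (Sum.inr i) - p (Sum.inr i) with hy
  set V : ℝ → ℝ := fun t => ∑ i, w i * y t i ^ 2 with hV
  have hyE : ∀ t, ‖y t‖ ≤ ‖E t - p‖ := fun t =>
    (pi_norm_le_iff_of_nonneg (norm_nonneg _)).2 fun i => norm_le_pi_norm (E t - p) (Sum.inr i)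
  have hVup : ∀ t, V t ≤ W * ‖E t - p‖ ^ 2 := by
    intro t
    rw [hW, Finset.sum_mul]
    refine Finset.sum_le_sum fun i _ => mul_le_mul_of_nonneg_left ?_ (hw0 i).le
    rw [← sq_abs]
    gcongr
    exact (norm_le_pi_norm (y t) i).trans (hyE t)
  have hVlow : ∀ t, c₁ * ‖y t‖ ^ 2 ≤ V t := by
    intro t
    refine (hcoer (y t)).trans (le_of_eq ?_)
    simp only [dotProduct, mulVec_diagonal, hV]
    exact Finset.sum_congr rfl fun i _ => by ring
  have hEc : ∀ i, ContinuousOn (fun t => E t i) (Set.Icc 0 T) := continuousOn_pi.1 hE.continuousOn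
  have hanti : AntitoneOn (fun t => V t * Real.exp (2 * α * t)) (Set.Icc 0 T) := by
    have hderiv : ∀ s ∈ interior (Set.Icc 0 T), ∃ D,
        HasDerivAt (fun t => V t * Real.exp (2 * α * t)) D s ∧ D ≤ 0 := by
      intro s hs
      have hsI : s ∈ Set.Icc 0 T := interior_subset hs
      have hnhds : Set.Icc 0 T ∈ nhds s := mem_interior_iff_mem_nhds.1 hs
      choose v hv hv' using hE.differential s hsI
      have hVd : HasDerivAt V (∑ i, w i * (2 * y s i * v i)) s := by
        refine HasDerivAt.fun_sum fun i _ => ?_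
        have := (((hv i).hasDerivAt hnhds).sub_const (p (Sum.inr i))).pow 2
        simpa using this.const_mul (w i)
      have hVle : ∑ i, w i * (2 * y s i * v i) ≤ -(2 * α) * V s := by
        have h1 := (h (E s) (hball s hsI) (hE.consistent s hsI).2).1
        have h2 : ∑ i, w i * (2 * y s i * v i)
            = 2 * ∑ i, y s i * (N.closedLoop (E s) (Sum.inr i) / p (Sum.inr i)) := by
          rw [Finset.mul_sum]
          refine Finset.sum_congr rfl fun i _ => ?_
          rw [← hv' i, hw]
          ring
        have h3 : α * V s ≤ c * ‖E s - p‖ ^ 2 := by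
          calc α * V s ≤ α * (W * ‖E s - p‖ ^ 2) := by gcongr; exact hVup s
            _ = _ := by rw [hα]; field_simp
        rw [h2]
        linarith
      have he : HasDerivAt (fun t => Real.exp (2 * α * t)) (Real.exp (2 * α * s) * (2 * α)) s := by
        simpa using ((hasDerivAt_id s).const_mul (2 * α)).exp
      refine ⟨_, hVd.mul he, ?_⟩
      nlinarith [Real.exp_pos (2 * α * s)]
    refine antitoneOn_of_deriv_nonpos (convex_Icc 0 T) ?_ ?_ ?_
    · refine ContinuousOn.mul ?_ (by fun_prop)
      exact continuousOn_finsetSum _ fun i _ =>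
        continuousOn_const.mul (((hEc (Sum.inr i)).sub continuousOn_const).pow 2)
    · intro s hs
      obtain ⟨D, hD, _⟩ := hderiv s hs
      exact hD.differentiableAt.differentiableWithinAt
    · intro s hs
      obtain ⟨D, hD, hD0⟩ := hderiv s hs
      rwa [hD.deriv]
  have h1 : V t * Real.exp (2 * α * t) ≤ V 0 := by
    simpa using hanti (Set.left_mem_Icc.2 hT) ht ht.1
  have h2 := (h (E t) (hball t ht) (hE.consistent t ht).2).2
  have hexp : Real.exp (-α * t) ^ 2 * Real.exp (2 * α * t) = 1 := by
    rw [← Real.exp_nat_mul, ← Real.exp_add]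
    ring_nf
    simp
  refine le_of_sq_le_sq ?_ (by positivity)
  have hVt : V t ≤ W * ‖E 0 - p‖ ^ 2 * Real.exp (-α * t) ^ 2 := by
    calc V t = V t * Real.exp (2 * α * t) * Real.exp (-α * t) ^ 2 := by
          linear_combination -(V t) * hexp
      _ ≤ _ := mul_le_mul_of_nonneg_right (h1.trans (hVup 0)) (sq_nonneg _)
  calc ‖E t - p‖ ^ 2 ≤ (C * ‖y t‖) ^ 2 := by gcongr
    _ = C ^ 2 / c₁ * (c₁ * ‖y t‖ ^ 2) := by field_simp
    _ ≤ C ^ 2 / c₁ * (W * ‖E 0 - p‖ ^ 2 * Real.exp (-α * t) ^ 2) :=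
        mul_le_mul_of_nonneg_left ((hVlow t).trans hVt) (by positivity)
    _ = _ := by
        rw [mul_pow, mul_pow, mul_pow, Real.sq_sqrt (by positivity)]
        ring

/-- Exponential decay of all solutions that start close to a dissipative equilibrium. -/
theorem exists_decay [Nonempty I] (N : Microgrid L I) {p : L ⊕ I → ℝ}
    {M : Matrix (L ⊕ I) (L ⊕ I) ℝ} (hp : N.IsEquilibrium p) (hM : (-M).PosDef)
    (hF : HasFDerivAt N.closedLoop (toLin' (diagonal p * M)).toContinuousLinearMap p) :
    ∃ δ > 0, ∃ C > 0, ∃ α > 0, ∀ T (E : ℝ → L ⊕ I → ℝ), N.IsSolutionOn (Set.Icc 0 T) E →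
      ‖E 0 - p‖ < δ →
      ∀ t ∈ Set.Icc 0 T, ‖E t - p‖ ≤ C * Real.exp (-α * t) * ‖E 0 - p‖ := by
  obtain ⟨r, hr, C, hC, α, hα, h⟩ := N.exists_decay_of_mem_ball hp hM hF
  -- This choice puts both the initial deviation and `C` times it below `r`, as the trapping
  -- argument requires.
  refine ⟨r / (C + 1), by positivity, C, hC, α, hα, fun T E hE h0 t ht => ?_⟩
  rw [lt_div_iff₀ (by positivity)] at h0
  have hn := norm_nonneg (E 0 - p)
  have htrap := ContinuousOn.forall_lt_of_trapping (f := fun t => ‖E t - p‖) (r := r)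
    (hE.continuousOn.sub continuousOn_const).norm (by nlinarith) (fun t ht hs => by
      have h1 := h t E (hE.mono (Set.Icc_subset_Icc_right ht.2)) hs t (Set.right_mem_Icc.2 ht.1)
      have h2 : Real.exp (-α * t) ≤ 1 := Real.exp_le_one_iff.2 (by nlinarith [ht.1])
      have h3 : C * Real.exp (-α * t) * ‖E 0 - p‖ ≤ C * 1 * ‖E 0 - p‖ := by gcongr
      obtain h4 | h4 := hn.eq_or_lt
      · rw [← h4] at h1
        linarith
      · linarith)
  exact h T E hE (fun t ht => (htrap t ht).le) t ht

end Microgrid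

/-! ### Global solutions and the constraint manifold -/

/-- A bounded, globally Lipschitz vector field has global forward solutions. -/
theorem LipschitzWith.exists_forall_hasDerivWithinAt_Ici {X : Type*} [NormedAddCommGroup X]
    [NormedSpace ℝ X] [CompleteSpace X] {f : X → X} {K : NNReal} (hf : LipschitzWith K f)
    {M : NNReal} (hM : ∀ x, ‖f x‖ ≤ M) (x₀ : X) :
    ∃ y : ℝ → X, y 0 = x₀ ∧ ∀ t ∈ Set.Ici (0 : ℝ), HasDerivWithinAt y (f (y t)) (Set.Ici 0) t := by
  have hloc : ∀ T : ℝ, 0 ≤ T → ∃ γ : ℝ → X, γ 0 = x₀ ∧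
      ∀ t ∈ Set.Icc 0 T, HasDerivWithinAt γ (f (γ t)) (Set.Icc 0 T) t := by
    intro T hT
    -- Speed at most `M` confines the curve to radius `M * T`, so one Picard step covers all of [0,
    -- T].
    have hPL : IsPicardLindelof (fun _ => f) (⟨0, Set.left_mem_Icc.2 hT⟩ : Set.Icc 0 T) x₀
        (M * T.toNNReal) 0 M K :=
      { lipschitzOnWith := fun _ _ => hf.lipschitzOnWith
        continuousOn := fun _ _ => continuousOn_const
        norm_le := fun _ _ x _ => hM x
        mul_max_le := by simp [hT] }
    exact hPL.exists_eq_forall_mem_Icc_hasDerivWithinAt₀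
  have hloc' : ∀ T : ℝ, ∃ γ : ℝ → X, 0 ≤ T → γ 0 = x₀ ∧
      ∀ t ∈ Set.Icc 0 T, HasDerivWithinAt γ (f (γ t)) (Set.Icc 0 T) t := by
    intro T
    by_cases hT : 0 ≤ T
    · obtain ⟨γ, hγ⟩ := hloc T hT
      exact ⟨γ, fun _ => hγ⟩
    · exact ⟨0, fun h => absurd h hT⟩
  choose γ hγ using hloc'
  have huniq : ∀ T T', 0 ≤ T → T ≤ T' → Set.EqOn (γ T) (γ T') (Set.Icc 0 T) := by
    intro T T' hT hTT'
    have hT' := hT.trans hTT'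
    have hsub : Set.Icc 0 T ⊆ Set.Icc 0 T' := Set.Icc_subset_Icc_right hTT'
    have hright : ∀ S, 0 ≤ S → ∀ t ∈ Set.Ico 0 S,
        HasDerivWithinAt (γ S) (f (γ S t)) (Set.Ici t) t := fun S hS t ht =>
      ((hγ S hS).2 t ⟨ht.1, ht.2.le⟩).mono_of_mem_nhdsWithin
        (Filter.mem_of_superset (Icc_mem_nhdsGE ht.2) (Set.Icc_subset_Icc_left ht.1))
    refine ODE_solution_unique (v := fun _ => f) (fun _ => hf)
      (fun t ht => ((hγ T hT).2 t ht).continuousWithinAt) (hright T hT)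
      (fun t ht => ((hγ T' hT').2 t (hsub ht)).continuousWithinAt.mono hsub)
      (fun t ht => hright T' hT' t ⟨ht.1, ht.2.trans_le hTT'⟩) ?_
    rw [(hγ T hT).1, (hγ T' hT').1]
  -- By uniqueness the curves on different intervals agree, so the diagonal `γ t t` glues them.
  refine ⟨fun t => γ t t, (hγ 0 le_rfl).1, fun t ht => ?_⟩
  have ht0 : 0 ≤ t := ht
  have ht1 : 0 ≤ t + 1 := by positivity
  have hd := (hγ (t + 1) ht1).2 t ⟨ht0, by linarith⟩
  have hmem : Set.Icc 0 (t + 1) ∈ nhdsWithin t (Set.Ici 0) := by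
    rw [← Set.Ici_inter_Iic]
    exact Filter.inter_mem self_mem_nhdsWithin
      (mem_nhdsWithin_of_mem_nhds (Iic_mem_nhds (by linarith)))
  have heq : ∀ s ∈ Set.Icc 0 (t + 1), γ s s = γ (t + 1) s := fun s hs =>
    huniq s (t + 1) hs.1 hs.2 (Set.right_mem_Icc.2 hs.1)
  have := (hd.mono_of_mem_nhdsWithin hmem).congr_of_eventuallyEq
    (Filter.mem_of_superset hmem heq) (heq t ⟨ht0, by linarith⟩)
  rwa [← heq t ⟨ht0, by linarith⟩] at this

/-- A vector field that is Lipschitz on a ball of `ι → ℝ` has global forward solutions of a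
globally defined modification of it that agrees with it on the ball. -/
theorem LipschitzOnWith.exists_forall_hasDerivWithinAt_Ici {ι : Type*} [Fintype ι]
    {f : (ι → ℝ) → ι → ℝ} {K : NNReal} {p : ι → ℝ} {ρ : ℝ} (hρ : 0 ≤ ρ)
    (hf : LipschitzOnWith K f (Metric.closedBall p ρ)) (x₀ : ι → ℝ) :
    ∃ y : ℝ → ι → ℝ, y 0 = x₀ ∧ ContinuousOn y (Set.Ici 0) ∧
      ∀ t ∈ Set.Ici (0 : ℝ), y t ∈ Metric.closedBall p ρ →
        HasDerivWithinAt y (f (y t)) (Set.Ici 0) t := by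
  -- Coordinatewise truncation is a 1-Lipschitz retraction onto the closed ball because the norm is
  -- the sup norm.
  set clamp : (ι → ℝ) → ι → ℝ := fun x i => max (p i - ρ) (min (x i) (p i + ρ)) with hclamp
  have hLip : LipschitzWith 1 clamp := by
    refine LipschitzWith.of_dist_le_mul fun x z => ?_
    rw [NNReal.coe_one, one_mul]
    refine (dist_pi_le_iff dist_nonneg).2 fun i => ?_
    refine le_trans ?_ (dist_le_pi_dist x z i)
    rw [Real.dist_eq, Real.dist_eq]
    refine (abs_max_sub_max_le_max _ _ _ _).trans (max_le (by simp) ?_)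
    exact (abs_min_sub_min_le_max _ _ _ _).trans (max_le le_rfl (by simp))
  have hmem : ∀ x, clamp x ∈ Metric.closedBall p ρ := by
    intro x
    rw [Metric.mem_closedBall]
    refine (dist_pi_le_iff hρ).2 fun i => ?_
    rw [Real.dist_eq, abs_le]
    constructor
    · have := le_max_left (p i - ρ) (min (x i) (p i + ρ))
      simp only [hclamp]; linarith
    · have : max (p i - ρ) (min (x i) (p i + ρ)) ≤ p i + ρ :=
        max_le (by linarith) (min_le_right _ _)
      simp only [hclamp]; linarith
  have hfix : ∀ x ∈ Metric.closedBall p ρ, clamp x = x := by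
    intro x hx
    funext i
    have := (dist_le_pi_dist x p i).trans hx
    rw [Real.dist_eq, abs_le] at this
    simp only [hclamp]
    rw [min_eq_left (by linarith), max_eq_right (by linarith)]
  have hfL : LipschitzWith K (f ∘ clamp) := by
    have := (hf.comp (hLip.lipschitzOnWith (s := Set.univ)) fun x _ => hmem x)
    rw [mul_one] at this
    exact lipschitzOnWith_univ.1 this
  have hbdd : ∀ x, ‖(f ∘ clamp) x‖ ≤ (‖f p‖₊ + K * ρ.toNNReal : NNReal) := by
    intro x
    have h1 := hf.dist_le_mul (clamp x) (hmem x) p (Metric.mem_closedBall_self hρ)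
    have h2 : dist (clamp x) p ≤ ρ := hmem x
    rw [dist_eq_norm] at h1
    calc ‖f (clamp x)‖ ≤ ‖f p‖ + ‖f (clamp x) - f p‖ := norm_le_norm_add_norm_sub' _ _
      _ ≤ ‖f p‖ + K * ρ := by
        gcongr
        exact h1.trans (by gcongr)
      _ = _ := by simp [hρ]
  obtain ⟨y, hy0, hy⟩ := hfL.exists_forall_hasDerivWithinAt_Ici hbdd x₀
  refine ⟨y, hy0, fun t ht => (hy t ht).continuousWithinAt, fun t ht hyt => ?_⟩
  have := hy t ht
  rwa [Function.comp_apply, hfix _ hyt] at this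

/-- Local parametrization of the zero set of the algebraic components by the differential
variables. -/
theorem exists_implicit_parametrization {L I : Type*} [Fintype L] [DecidableEq L] [Fintype I]
    [DecidableEq I] {F : (L ⊕ I → ℝ) → L ⊕ I → ℝ} {p : L ⊕ I → ℝ}
    {M : Matrix (L ⊕ I) (L ⊕ I) ℝ} (hp : ∀ i, 0 < p i) (hM : (-M).PosDef) (hFp : F p = 0)
    (hF : HasStrictFDerivAt F (toLin' (diagonal p * M)).toContinuousLinearMap p) :
    ∃ (h : (I → ℝ) → L ⊕ I → ℝ) (h' : (I → ℝ) →L[ℝ] (L ⊕ I → ℝ)),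
      HasStrictFDerivAt h h' (p ∘ Sum.inr) ∧ h (p ∘ Sum.inr) = p ∧
      (∀ᶠ y in nhds (p ∘ Sum.inr), (∀ i, F (h y) (Sum.inl i) = 0) ∧ h y ∘ Sum.inr = y) ∧
      ∀ᶠ E in nhds p, (∀ i, F E (Sum.inl i) = 0) → h (E ∘ Sum.inr) = E := by
  set A := (toLin' (diagonal p * M)).toContinuousLinearMap with hA
  set P := fun i => ContinuousLinearMap.proj (R := ℝ) (φ := fun _ : L ⊕ I => ℝ) i with hP
  -- Keep the load equations and replace the inverter equations by the inverter coordinates;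
  -- inverting `Φ` at (0, y) solves the constraints.
  set Φ : (L ⊕ I → ℝ) → L ⊕ I → ℝ :=
    fun E => Sum.elim (fun i => F E (Sum.inl i)) (fun i => E (Sum.inr i)) with hΦ
  set D : (L ⊕ I → ℝ) →L[ℝ] (L ⊕ I → ℝ) := ContinuousLinearMap.pi
    (Sum.elim (fun i => (P (Sum.inl i)).comp A) (fun i => P (Sum.inr i))) with hD
  have hΦD : HasStrictFDerivAt Φ D p := by
    rw [hasStrictFDerivAt_pi']
    rintro (i | i)
    · exact (hasStrictFDerivAt_pi'.1 hF) (Sum.inl i)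
    · exact (P (Sum.inr i)).hasStrictFDerivAt
  -- For `x` in the kernel, `M *ᵥ x` vanishes at the loads and `x` at the inverters, so xᵀMx = 0.
  have hinj : Function.Injective D := by
    rw [injective_iff_map_eq_zero]
    intro x hx
    have hl : ∀ i : L, (M *ᵥ x) (Sum.inl i) = 0 := by
      intro i
      have := congrFun hx (Sum.inl i)
      have h0 := (hp (Sum.inl i)).ne'
      simpa [hD, hP, hA, ← mulVec_mulVec, mulVec_diagonal, h0, -mulVec_mulVec] using this
    have hr : ∀ i : I, x (Sum.inr i) = 0 := fun i => congrFun hx (Sum.inr i)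
    by_contra hx0
    have := hM.dotProduct_mulVec_pos hx0
    simp [dotProduct, neg_mulVec, Fintype.sum_sum_type, hl, hr] at this
  set e : (L ⊕ I → ℝ) ≃L[ℝ] (L ⊕ I → ℝ) :=
    (LinearEquiv.ofInjectiveEndo (D : (L ⊕ I → ℝ) →ₗ[ℝ] (L ⊕ I → ℝ)) hinj).toContinuousLinearEquiv
  have hΦe : HasStrictFDerivAt Φ (e : (L ⊕ I → ℝ) →L[ℝ] (L ⊕ I → ℝ)) p := by
    refine hΦD.congr_fderiv ?_
    ext x
    rfl
  set Ψ := hΦe.localInverse Φ e p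
  have hleft := hΦe.eventually_left_inverse
  have hright := hΦe.eventually_right_inverse
  have hΨ := hΦe.to_localInverse
  set J : (I → ℝ) →L[ℝ] (L ⊕ I → ℝ) := ContinuousLinearMap.pi
    (Sum.elim (fun _ => 0) (fun i => ContinuousLinearMap.proj i)) with hJ
  have hJe : ∀ y, J y = Sum.elim (fun _ => 0) y := by
    intro y
    funext i
    rcases i with i | i <;> simp [hJ]
  have hΦp : J (p ∘ Sum.inr) = Φ p := by
    rw [hJe]
    funext i
    rcases i with i | i <;> simp [hΦ, hFp]
  refine ⟨fun y => Ψ (J y), (e.symm : (L ⊕ I → ℝ) →L[ℝ] (L ⊕ I → ℝ)).comp J, ?_, ?_, ?_, ?_⟩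
  · rw [← hΦp] at hΨ
    exact hΨ.comp (p ∘ Sum.inr) J.hasStrictFDerivAt
  · simp only [hΦp]
    exact hleft.self_of_nhds
  · have hJc : Filter.Tendsto J (nhds (p ∘ Sum.inr)) (nhds (Φ p)) := by
      rw [← hΦp]
      exact J.continuous.continuousAt
    filter_upwards [hJc.eventually hright] with y hy
    rw [hJe] at hy ⊢
    exact ⟨fun i => congrFun hy (Sum.inl i), funext fun i => congrFun hy (Sum.inr i)⟩
  · filter_upwards [hleft] with E hE hEL
    have : J (E ∘ Sum.inr) = Φ E := by
      rw [hJe]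
      funext i
      rcases i with i | i <;> simp [hΦ, hEL]
    rw [this]
    exact hE

/-! ### Stability of the differential-algebraic system -/

namespace Microgrid

variable {L I : Type*} [Fintype L] [DecidableEq L] [Fintype I] [DecidableEq I]

theorem locallyExponentiallyStable_of_neg_posDef [Nonempty I] (N : Microgrid L I)
    {p : L ⊕ I → ℝ} {M : Matrix (L ⊕ I) (L ⊕ I) ℝ} (hp : N.IsEquilibrium p) (hM : (-M).PosDef)
    (hF : HasStrictFDerivAt N.closedLoop (toLin' (diagonal p * M)).toContinuousLinearMap p) :
    N.LocallyExponentiallyStable p := by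
  obtain ⟨δ₁, hδ₁, C, hC, α, hα, hdecay⟩ := N.exists_decay hp hM hF.hasFDerivAt
  obtain ⟨h, h', hh, hhp, hpar, huniq⟩ := exists_implicit_parametrization hp.1 hM hp.2 hF
  set q : I → ℝ := p ∘ Sum.inr with hq
  set f : (I → ℝ) → I → ℝ := fun y i => (N.τ i)⁻¹ * N.closedLoop (h y) (Sum.inr i) with hf
  have hFh : HasStrictFDerivAt (fun y => N.closedLoop (h y)) _ q :=
    HasStrictFDerivAt.comp q (by rw [hhp]; exact hF) hh
  have hf' : HasStrictFDerivAt f _ q := hasStrictFDerivAt_pi.2 fun i =>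
    ((hasStrictFDerivAt_pi'.1 hFh) (Sum.inr i)).const_mul (N.τ i)⁻¹
  obtain ⟨K, s, hs, hfK⟩ := hf'.exists_lipschitzOnWith
  obtain ⟨K', s', hs', hhK⟩ := hh.exists_lipschitzOnWith
  have hhpos : ∀ᶠ y in nhds q, ∀ i, 0 < h y i := by
    refine Filter.eventually_all.2 fun i => ?_
    have : Filter.Tendsto (fun y => h y i) (nhds q) (nhds (p i)) := by
      have := (continuousAt_pi.1 hh.continuousAt i).tendsto
      rwa [hhp] at this
    exact this.eventually (lt_mem_nhds (hp.1 i))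
  obtain ⟨ρ, hρ, hball⟩ := Metric.nhds_basis_closedBall.mem_iff.1
    (Filter.inter_mem (Filter.inter_mem hs hs') (hpar.and hhpos))
  obtain ⟨δ₂, hδ₂, hball₂⟩ := Metric.eventually_nhds_iff_ball.1 huniq
  refine ⟨hp, min (min δ₁ δ₂) (ρ / (C + 1)), by positivity, C, hC, α, hα, fun E₀ hE₀ hδ => ?_,
    fun T E hE hδ => hdecay T E hE (hδ.trans_le ((min_le_left _ _).trans (min_le_left _ _)))⟩
  have hd₁ : ‖E₀ - p‖ < δ₁ := hδ.trans_le ((min_le_left _ _).trans (min_le_left _ _))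
  have hd₂ : ‖E₀ - p‖ < δ₂ := hδ.trans_le ((min_le_left _ _).trans (min_le_right _ _))
  have hdρ : ‖E₀ - p‖ * (C + 1) < ρ := by
    rw [← lt_div_iff₀ (by positivity)]
    exact hδ.trans_le (min_le_right _ _)
  have hn := norm_nonneg (E₀ - p)
  obtain ⟨y, hy0, hyc, hy⟩ := LipschitzOnWith.exists_forall_hasDerivWithinAt_Ici hρ.le
    (hfK.mono fun y hy => (hball hy).1.1) (E₀ ∘ Sum.inr)
  have hh0 : h (y 0) = E₀ := by
    rw [hy0]
    exact hball₂ E₀ (mem_ball_iff_norm.2 hd₂) hE₀.2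
  -- Stated for any time set `s`: it is needed on compact intervals to apply the decay estimate, and
  -- on [0, ∞) once trapping is known.
  have hsol : ∀ s ⊆ Set.Ici (0 : ℝ), (∀ t ∈ s, y t ∈ Metric.closedBall q ρ) →
      N.IsSolutionOn s fun t => h (y t) := by
    intro s hs hys
    refine ⟨?_, fun t ht => ?_, fun t ht i => ?_⟩
    · exact hhK.continuousOn.comp (hyc.mono hs) fun t ht => (hball (hys t ht)).1.2
    · have := (hball (hys t ht)).2
      exact ⟨this.2, this.1.1⟩
    · refine ⟨f (y t) i, ?_, ?_⟩
      · have hd := (hasDerivWithinAt_pi.1 ((hy t (hs ht) (hys t ht)).mono hs)) i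
        have heq : ∀ r ∈ s, h (y r) (Sum.inr i) = y r i := fun r hr =>
          congrFun (hball (hys r hr)).2.1.2 i
        exact hd.congr heq (heq t ht)
      · have := (N.τ_pos i).ne'
        simp only [hf]
        field_simp
  have hle : ∀ E : L ⊕ I → ℝ, ‖E ∘ Sum.inr - q‖ ≤ ‖E - p‖ := fun E =>
    (pi_norm_le_iff_of_nonneg (norm_nonneg _)).2 fun i => norm_le_pi_norm (E - p) (Sum.inr i)
  -- While `y` stays in the ball, `h ∘ y` solves the system, so the decay estimate pushes `y`
  -- strictly inside.
  have hin : ∀ t ∈ Set.Ici (0 : ℝ), y t ∈ Metric.closedBall q ρ := by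
    intro t ht
    have hsub : Set.Icc 0 t ⊆ Set.Ici 0 := Set.Icc_subset_Ici_self
    refine mem_closedBall_iff_norm.2 (ContinuousOn.forall_lt_of_trapping
      (f := fun t => ‖y t - q‖) (r := ρ) (T := t)
      ((hyc.mono hsub).sub continuousOn_const).norm ?_ (fun r hr hbd => ?_) t
      (Set.right_mem_Icc.2 ht)).le
    · rw [hy0]
      exact (hle E₀).trans (by nlinarith)
    · have hyr : ∀ s ∈ Set.Icc 0 r, y s ∈ Metric.closedBall q ρ := fun s hs =>
        mem_closedBall_iff_norm.2 (hbd s hs)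
      have hE := hsol (Set.Icc 0 r) Set.Icc_subset_Ici_self hyr
      have h1 := hdecay r _ hE (by rwa [hh0]) r (Set.right_mem_Icc.2 hr.1)
      have h2 : Real.exp (-α * r) ≤ 1 := Real.exp_le_one_iff.2 (by nlinarith [hr.1])
      have h3 : C * Real.exp (-α * r) * ‖E₀ - p‖ ≤ C * 1 * ‖E₀ - p‖ := by gcongr
      have h4 := hle (h (y r))
      rw [(hball (hyr r (Set.right_mem_Icc.2 hr.1))).2.1.2] at h4
      simp only [hh0] at h1
      obtain h5 | h5 := hn.eq_or_lt
      · rw [← h5] at h1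
        linarith
      · linarith
  exact ⟨fun t => h (y t), hsol _ subset_rfl hin, hh0⟩

end Microgrid

theorem theorem2 {L I : Type*} [Fintype L] [DecidableEq L] [Nonempty L]
    [Fintype I] [DecidableEq I] [Nonempty I]
    (N : Microgrid L I) (EL : L → ℝ) (hpos : ∀ i, 0 < EL i) (hsol : N.reducedFlow EL = 0) :
    HasFDerivAt N.reducedFlow (Matrix.toLin' (N.Jred EL)).toContinuousLinearMap EL ∧
    N.IsEquilibrium (Sum.elim EL (N.inverterVoltages EL)) ∧
    (IsHurwitz (N.Jred EL) →
      N.LocallyExponentiallyStable (Sum.elim EL (N.inverterVoltages EL))) ∧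
    ((∀ i, deriv (N.Q i) (EL i) ≤ 0) →
      (Matrix.diagonal (fun i => N.QL EL i / EL i ^ 2) - N.Bred).PosDef →
      IsHurwitz (N.Jred EL)) :=
  ⟨N.hasFDerivAt_reducedFlow hpos, N.profile_isEquilibrium hpos hsol,
    fun h => N.locallyExponentiallyStable_of_neg_posDef (N.profile_isEquilibrium hpos hsol)
      ((N.isHurwitz_Jred_iff hpos).1 h) (N.hasStrictFDerivAt_closedLoop hpos),
    N.isHurwitz_Jred_of_posDef hpos hsol⟩
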